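/- For a group $G$ and an element $g$ of its derived subgroup $[G,G]$, the commutator length of $g$ is the least $n \ge 0$ for which there are $x_1,\dots,x_n,y_1,\dots,y_n \in G$ with $g=[x_1,y_1]\cdots[x_n,y_n]$, where $[x,y]=xyx^{-1}y^{-1}$ (so the identity has commutator length $0$). The commutator width $\mathrm{cw}(G)$ is the maximum (in general, the supremum in $\mathbb{N}\cup\{\infty\}$) of the commutator lengths of the elements of $[G,G]$. Let $S_n$ and $A_n$ denote the symmetric and the alternating group on $n$ points. Then: 1. for every prime $p$ and every integer $k>1$, every Sylow $p$-subgroup $P$ of $S_{p^k}$ satisfies $\mathrm{cw}(P)=1$; 2. for every prime $p>2$ and every integer $k>1$, every Sylow $p$-subgroup $P$ of $A_{p^k}$ satisfies $\mathrm{cw}(P)=1$. -/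

import Mathlib

/-- `IsProdOfCommutators n g`: there are `x₁, …, xₙ, y₁, …, yₙ` with
`g = [x₁, y₁] ⋯ [xₙ, yₙ]`, where `[x, y] = x * y * x⁻¹ * y⁻¹`. -/
def IsProdOfCommutators {G : Type*} [Group G] (n : ℕ) (g : G) : Prop :=
  ∃ x y : Fin n → G, g = (List.ofFn fun i => x i * y i * (x i)⁻¹ * (y i)⁻¹).prod

/-- The commutator length of `g`: the least `n` such that `g` is a product of `n` commutators
(it is `⊤` exactly when there is no such `n`, that is, off the derived subgroup). -/
noncomputable def commutatorLength {G : Type*} [Group G] (g : G) : ℕ∞ :=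
  ⨅ (n : ℕ) (_ : IsProdOfCommutators n g), (n : ℕ∞)

/-- The commutator width of a group: the supremum in `ℕ∞` of the commutator lengths of the
elements of its derived subgroup (a maximum whenever it is finite). -/
noncomputable def commutatorWidth (G : Type*) [Group G] : ℕ∞ :=
  ⨆ g ∈ commutator G, commutatorLength g

open scoped commutatorElement

/-! A Sylow `p`-subgroup of `S_{p^k}` is an iterated wreath product of cyclic groups of order `p`.
By induction, every derived element of it is a commutator: in `D ≀ᵣ C`, with `C` finite cyclic, such
an element lies in the base, and the ordered product of its coordinates is in `[D, D]`, hence a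
single commutator; `mem_commutatorSet_of_prod_eq` then solves for the whole element. For `k > 1` the
group is nonabelian, so the width is not 0. For odd `p`, `A_n` has index 2, so its Sylow subgroups
are those of `S_n`. -/

/-- A commutator is a product of one commutator in the sense of `IsProdOfCommutators`. -/
theorem isProdOfCommutators_one_commutatorElement {G : Type*} [Group G] (x y : G) :
    IsProdOfCommutators 1 ⁅x, y⁆ :=
  ⟨fun _ => x, fun _ => y, by simp [commutatorElement_def]⟩

theorem isProdOfCommutators_zero_iff {G : Type*} [Group G] {g : G} :
    IsProdOfCommutators 0 g ↔ g = 1 := by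
  simp [IsProdOfCommutators]

/-- A nonabelian group in which every element of the derived subgroup is a commutator has
commutator width one. -/
theorem commutatorWidth_eq_one {G : Type*} [Group G]
    (h : (commutator G : Set G) ⊆ commutatorSet G) (hG : ∃ x y : G, ⁅x, y⁆ ≠ 1) :
    commutatorWidth G = 1 := by
  apply le_antisymm
  · refine iSup₂_le fun g hg => ?_
    obtain ⟨x, y, rfl⟩ := h hg
    exact iInf₂_le 1 (isProdOfCommutators_one_commutatorElement x y)
  · obtain ⟨x, y, hxy⟩ := hG
    have hmem : ⁅x, y⁆ ∈ commutator G :=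
      Subgroup.commutator_mem_commutator (Subgroup.mem_top x) (Subgroup.mem_top y)
    refine le_trans (le_iInf₂ fun n hn => ?_)
      (le_iSup₂ (f := fun g (_ : g ∈ commutator G) => commutatorLength g) _ hmem)
    rcases n with _ | n
    · exact absurd (isProdOfCommutators_zero_iff.1 hn) hxy
    · exact_mod_cast Nat.succ_le_succ n.zero_le

theorem IsProdOfCommutators.map {G H : Type*} [Group G] [Group H] (f : G →* H) {n : ℕ} {g : G}
    (hg : IsProdOfCommutators n g) : IsProdOfCommutators n (f g) := by
  obtain ⟨x, y, rfl⟩ := hg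
  refine ⟨f ∘ x, f ∘ y, ?_⟩
  rw [map_list_prod, List.map_ofFn]
  congr 2
  funext i
  simp

theorem commutatorLength_map_le {G H : Type*} [Group G] [Group H] (f : G →* H) (g : G) :
    commutatorLength (f g) ≤ commutatorLength g :=
  le_iInf₂ fun n hn => iInf₂_le n (hn.map f)

theorem commutatorWidth_le_of_surjective {G H : Type*} [Group G] [Group H] (f : G →* H)
    (hf : Function.Surjective f) : commutatorWidth H ≤ commutatorWidth G := by
  refine iSup₂_le fun h hh => ?_
  have hmap : (commutator G).map f = commutator H := by
    rw [map_commutator_eq, MonoidHom.range_eq_top.2 hf, commutator_def]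
  obtain ⟨g, hg, rfl⟩ := hmap.symm ▸ hh
  exact (commutatorLength_map_le f g).trans
    (le_iSup₂ (f := fun g (_ : g ∈ commutator G) => commutatorLength g) g hg)

/-- The commutator width is an isomorphism invariant. -/
theorem commutatorWidth_congr {G H : Type*} [Group G] [Group H] (e : G ≃* H) :
    commutatorWidth G = commutatorWidth H :=
  le_antisymm (commutatorWidth_le_of_surjective e.symm.toMonoidHom e.symm.surjective)
    (commutatorWidth_le_of_surjective e.toMonoidHom e.surjective)

namespace RegularWreathProduct

/-- The homomorphism from `D ≀ᵣ Q` to the abelianization of `D` multiplying all coordinates of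
the base component. -/
def prodAbelianization (D Q : Type*) [Group D] [Group Q] [Fintype Q] :
    D ≀ᵣ Q →* Abelianization D where
  toFun z := ∏ q, Abelianization.of (z.left q)
  map_one' := by simp
  map_mul' z w := by
    simp only [mul_left, Pi.mul_apply, map_mul, Finset.prod_mul_distrib]
    congr 1
    -- The top component of `z` only permutes the coordinates of `w`.
    exact Fintype.prod_equiv (Equiv.mulLeft z.right⁻¹) _ _ fun _ => rfl

theorem prodAbelianization_eq_one_of_mem_commutator {D Q : Type*} [Group D] [Group Q] [Fintype Q]
    {z : D ≀ᵣ Q} (hz : z ∈ commutator (D ≀ᵣ Q)) : prodAbelianization D Q z = 1 :=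
  Abelianization.commutator_subset_ker _ hz

theorem right_eq_one_of_mem_commutator {D Q : Type*} [Group D] [CommGroup Q]
    {z : D ≀ᵣ Q} (hz : z ∈ commutator (D ≀ᵣ Q)) : z.right = 1 :=
  Abelianization.commutator_subset_ker (rightHom : D ≀ᵣ Q →* Q) hz

/-- If the ordered product of the coordinates of `f` is a commutator in `D`, then `(f, 1)` is a
commutator in the wreath product of `D` with a cyclic group. -/
theorem mem_commutatorSet_of_prod_eq {D : Type*} [Group D] {m : ℕ} (f : Fin (m + 1) → D) (h a : D)
    (hf : (List.ofFn f).prod = ⁅h, a⁆) :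
    (⟨fun i => f i.toAdd, 1⟩ : D ≀ᵣ Multiplicative (ZMod (m + 1))) ∈
      commutatorSet (D ≀ᵣ Multiplicative (ZMod (m + 1))) := by
  -- With `σ` the cyclic shift, `[(c, σ), (g, 1)] = (f, 1)` amounts to `c i * g (i - 1) = f i * g i
  -- * c i`. Taking `c i = 1` for `i ≠ 0` forces `g i = (F i)⁻¹ * K` for a constant `K`. At `i = 0`
  -- the cycle closes up for `c 0 = h` and `K = h * a * h⁻¹`, because `F m = ⁅h, a⁆`.
  let F : ℕ → D := fun j => ((List.ofFn f).take (j + 1)).prod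
  let g : Fin (m + 1) → D := fun i => (F i)⁻¹ * (h * a * h⁻¹)
  let c : Fin (m + 1) → D := Fin.cons h fun _ => 1
  have hF0 : F 0 = f 0 := by simp [F, List.ofFn_succ]
  have hFs (j : Fin m) : F (j.castSucc + 1 : ℕ) = F j * f j.succ := by
    simp only [F]
    rw [List.prod_take_succ _ _ (by simp)]
    simp [Fin.succ]
  have hFm : F m = ⁅h, a⁆ := by
    rw [← hf]
    simp only [F]
    rw [List.take_of_length_le (by simp)]
  have key (i : Fin (m + 1)) : c i * g (i - 1) = f i * g i * c i := by
    refine Fin.cases ?_ (fun j => ?_) i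
    · have : ((0 - 1 : Fin (m + 1)) : ℕ) = m := by
        rw [zero_sub, Fin.coe_neg_one]
      simp only [g, c, Fin.cons_zero, this, hFm, Fin.val_zero, hF0, commutatorElement_def]
      group
    · have : ((j.succ - 1 : Fin (m + 1)) : ℕ) = j := by
        rw [Fin.coe_sub_one]; simp
      have h2 := hFs j
      simp only [Fin.val_castSucc] at h2
      simp only [g, c, Fin.cons_succ, this, Fin.val_succ, h2]
      group
  refine ⟨⟨fun i => c i.toAdd, Multiplicative.ofAdd 1⟩, ⟨fun i => g i.toAdd, 1⟩, ?_⟩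
  rw [commutatorElement_def, mul_inv_eq_iff_eq_mul, mul_inv_eq_iff_eq_mul]
  apply RegularWreathProduct.ext
  · funext i
    have := key i.toAdd
    simp only [mul_left, mul_right, Pi.mul_apply, inv_one, one_mul, mul_one, toAdd_mul, toAdd_inv,
      toAdd_ofAdd]
    rw [neg_add_eq_sub]
    exact this
  · simp

/-- The property that derived elements are commutators passes from `D` to the wreath product of
`D` with a finite cyclic group. -/
theorem commutator_subset_commutatorSet {D : Type*} [Group D] {n : ℕ} [NeZero n]
    (hD : (commutator D : Set D) ⊆ commutatorSet D) :
    (commutator (D ≀ᵣ Multiplicative (ZMod n)) : Set (D ≀ᵣ Multiplicative (ZMod n))) ⊆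
      commutatorSet (D ≀ᵣ Multiplicative (ZMod n)) := by
  obtain ⟨m, rfl⟩ := Nat.exists_eq_succ_of_ne_zero (NeZero.ne n)
  intro z hz
  have hr := right_eq_one_of_mem_commutator hz
  have hp := prodAbelianization_eq_one_of_mem_commutator hz
  obtain ⟨l, r⟩ := z
  obtain rfl : r = 1 := hr
  let f : Fin (m + 1) → D := fun i => l (Multiplicative.ofAdd (i : ZMod (m + 1)))
  have hprod : (List.ofFn f).prod ∈ commutator D := by
    -- Modulo `[D, D]` the order of the factors is irrelevant.
    rw [← Abelianization.ker_of D, MonoidHom.mem_ker, map_list_prod, List.map_ofFn, List.prod_ofFn, ← hp]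
    exact Fintype.prod_equiv (Multiplicative.ofAdd (α := ZMod (m + 1))) _ _ fun _ => rfl
  obtain ⟨h, a, hha⟩ := hD hprod
  exact mem_commutatorSet_of_prod_eq f h a hha.symm

theorem exists_commutatorElement_ne_one {D Q : Type*} [Group D] [Group Q] [Nontrivial D]
    [Nontrivial Q] : ∃ x y : D ≀ᵣ Q, ⁅x, y⁆ ≠ 1 := by
  classical
  obtain ⟨d, hd⟩ := exists_ne (1 : D)
  obtain ⟨q, hq⟩ := exists_ne (1 : Q)
  -- Conjugation by `q ≠ 1` moves the support away from coordinate 1.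
  refine ⟨⟨Pi.mulSingle 1 d, 1⟩, inl q, fun h => hd ?_⟩
  have := congrFun (congrArg RegularWreathProduct.left (commutatorElement_eq_one_iff_mul_comm.1 h)) 1
  simpa [Pi.mulSingle_apply, hq] using this

end RegularWreathProduct

theorem IteratedWreathProduct.commutator_subset_commutatorSet (n : ℕ) [NeZero n] (k : ℕ) :
    (commutator (IteratedWreathProduct (Multiplicative (ZMod n)) k) : Set _) ⊆
      commutatorSet (IteratedWreathProduct (Multiplicative (ZMod n)) k) := by
  induction k with
  | zero => exact fun z _ => ⟨1, 1, Subsingleton.elim (α := PUnit) _ _⟩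
  | succ k ih => exact RegularWreathProduct.commutator_subset_commutatorSet ih

theorem IteratedWreathProduct.nontrivial_succ (G : Type*) [Group G] [Nontrivial G] (k : ℕ) :
    Nontrivial (IteratedWreathProduct G (k + 1)) :=
  (show Function.Injective (RegularWreathProduct.inl : G →* IteratedWreathProduct G k ≀ᵣ G) from
    fun _ _ h => congrArg RegularWreathProduct.right h).nontrivial

theorem IteratedWreathProduct.commutatorWidth_eq_one {n k : ℕ} (hn : 1 < n) (hk : 1 < k) :
    commutatorWidth (IteratedWreathProduct (Multiplicative (ZMod n)) k) = 1 := by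
  have : NeZero n := ⟨by omega⟩
  have : Fact (1 < n) := ⟨hn⟩
  refine _root_.commutatorWidth_eq_one (commutator_subset_commutatorSet n k) ?_
  obtain ⟨j, rfl⟩ : ∃ j, k = j + 1 + 1 := ⟨k - 2, by omega⟩
  have := nontrivial_succ (Multiplicative (ZMod n)) j
  exact RegularWreathProduct.exists_commutatorElement_ne_one
    (D := IteratedWreathProduct (Multiplicative (ZMod n)) (j + 1)) (Q := Multiplicative (ZMod n))

theorem Sylow.commutatorWidth_perm_eq_one {p k : ℕ} (hp : p.Prime) (hk : 1 < k)
    (P : Sylow p (Equiv.Perm (Fin (p ^ k)))) : commutatorWidth P = 1 := by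
  have : Fact p.Prime := ⟨hp⟩
  rw [commutatorWidth_congr (P.mulEquivIteratedWreathProduct p k (Fin (p ^ k)) (by simp)
    (Multiplicative (ZMod p)) (by simp))]
  exact IteratedWreathProduct.commutatorWidth_eq_one hp.one_lt hk

/-- A Sylow subgroup of a subgroup of index prime to `p` is isomorphic to a Sylow subgroup of the
whole group. -/
theorem Sylow.exists_mulEquiv_of_not_dvd_index {G : Type*} [Group G] [Finite G] {p : ℕ}
    [hp : Fact p.Prime] {H : Subgroup G} (hH : ¬ p ∣ H.index) (P : Sylow p H) :
    ∃ Q : Sylow p G, Nonempty (P ≃* Q) := by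
  let e := (P : Subgroup H).equivMapOfInjective H.subtype H.subtype_injective
  -- As `p` does not divide the index, `H` and `G` have the same `p`-part, so the image of `P` has
  -- full Sylow order.
  refine ⟨Sylow.ofCard ((P : Subgroup H).map H.subtype) ?_, ⟨e⟩⟩
  rw [← Nat.card_congr e.toEquiv, ← H.card_mul_index,
    Nat.factorization_mul Nat.card_pos.ne' H.index_ne_zero_of_finite, Finsupp.add_apply,
    Nat.factorization_eq_zero_of_not_dvd hH, add_zero]
  exact P.card_eq_multiplicity

theorem mainTheorem3 :
    (∀ p k : ℕ, p.Prime → 1 < k →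
      ∀ P : Sylow p (Equiv.Perm (Fin (p ^ k))), commutatorWidth P = 1) ∧
    (∀ p k : ℕ, p.Prime → 2 < p → 1 < k →
      ∀ P : Sylow p (alternatingGroup (Fin (p ^ k))), commutatorWidth P = 1) := by
  refine ⟨fun p k hp hk P => P.commutatorWidth_perm_eq_one hp hk, fun p k hp h2 hk P => ?_⟩
  have : Fact p.Prime := ⟨hp⟩
  have : Nontrivial (Fin (p ^ k)) :=
    Fin.nontrivial_iff_two_le.2 (Nat.one_lt_pow (by omega) hp.one_lt)
  have hindex : ¬ p ∣ (alternatingGroup (Fin (p ^ k))).index := by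
    rw [alternatingGroup.index_eq_two]
    exact Nat.not_dvd_of_pos_of_lt two_pos h2
  obtain ⟨Q, ⟨e⟩⟩ := P.exists_mulEquiv_of_not_dvd_index hindex
  rw [commutatorWidth_congr e, Q.commutatorWidth_perm_eq_one hp hk]
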